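/- All graphs are finite, simple and undirected. An edge-colouring of a graph is \emph{proper} if any two distinct edges sharing a vertex receive different colours; a \emph{rainbow path} is a path whose edges receive pairwise distinct colours. For a connected graph $G$, the chromatic index $\chi'(G)$ is the least number of colours in a proper edge-colouring of $G$, and the proper rainbow connection number $prc(G)$ is the least number of colours in a proper edge-colouring of $G$ in which any two vertices are joined by a rainbow path. Let $P_4$ be the path on $4$ vertices. Let $Z_2$ be the graph on $5$ vertices that consists of a triangle together with a path of length $2$ attached by one end-vertex to a vertex of the triangle. Let $G_{6.3}$ be the graph on $\{w,w_1,w_2,w_3,u_1,u_2\}$ whose $8$ edges are those of the triangles $ww_2w_3$ and $w_1u_1u_2$ together with $ww_1$ and $w_2u_2$. \textbf{Theorem.} Let $G$ be a connected graph of order $n\ge 3$ with $$|E(G)|\ge \binom{n-2}{2}+2.$$ Then $prc(G)=\chi'(G)$, or $G$ is isomorphic to one of $P_4$, $Z_2$, $G_{6.3}$. -/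

import Mathlib

namespace PRC

variable {V : Type*} {G : SimpleGraph V}

/-- An edge-colouring is proper: distinct edges sharing a vertex get different colours. -/
def IsProper {K : Type*} (c : G.EdgeLabeling K) : Prop :=
  ∀ e f : G.edgeSet, e ≠ f → (∃ v : V, v ∈ (e : Sym2 V) ∧ v ∈ (f : Sym2 V)) → c e ≠ c f

/-- A walk is a rainbow path: it is a path whose edges get pairwise distinct colours. -/
def IsRainbowPath {K : Type*} (c : G.EdgeLabeling K) {u v : V} (p : G.Walk u v) : Prop :=
  p.IsPath ∧ ∀ e f : G.edgeSet, (e : Sym2 V) ∈ p.edges → (f : Sym2 V) ∈ p.edges →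
    e ≠ f → c e ≠ c f

/-- Any two vertices are joined by a rainbow path. -/
def IsRainbowConnected {K : Type*} (c : G.EdgeLabeling K) : Prop :=
  ∀ u v : V, ∃ p : G.Walk u v, IsRainbowPath c p

/-- A proper edge-colouring that makes the graph rainbow connected. -/
def IsProperlyRainbowConnected {K : Type*} (c : G.EdgeLabeling K) : Prop :=
  IsProper c ∧ IsRainbowConnected c

/-- The chromatic index `χ'(G)`: the least number of colours in a proper edge-colouring. -/
noncomputable def chromaticIndex (G : SimpleGraph V) : ℕ :=
  sInf {k : ℕ | ∃ c : G.EdgeLabeling (Fin k), IsProper c}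

/-- The proper rainbow connection number `prc(G)`: the least number of colours in an
edge-colouring making `G` properly rainbow connected. -/
noncomputable def prc (G : SimpleGraph V) : ℕ :=
  sInf {k : ℕ | ∃ c : G.EdgeLabeling (Fin k), IsProperlyRainbowConnected c}

/-- The set defining `prc` is nonempty for a connected graph with finitely many edges. -/
theorem prc_set_nonempty (hG : G.Connected) [Finite G.edgeSet] :
    {k : ℕ | ∃ c : G.EdgeLabeling (Fin k), IsProperlyRainbowConnected c}.Nonempty := by
  classical
  refine ⟨Nat.card G.edgeSet, fun e => Finite.equivFin G.edgeSet e, ?_, ?_⟩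
  · intro e f hef _ h
    exact hef ((Finite.equivFin G.edgeSet).injective h)
  · intro u v
    obtain ⟨p, hp⟩ := (hG.preconnected u v).exists_isPath
    refine ⟨p, hp, ?_⟩
    intro e f _ _ hef h
    exact hef ((Finite.equivFin G.edgeSet).injective h)

/-- The set defining `chromaticIndex` is nonempty for a graph with finitely many edges. -/
theorem chromaticIndex_set_nonempty [Finite G.edgeSet] :
    {k : ℕ | ∃ c : G.EdgeLabeling (Fin k), IsProper c}.Nonempty :=
  ⟨Nat.card G.edgeSet, fun e => Finite.equivFin G.edgeSet e, fun _ _ hef _ h =>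
    hef ((Finite.equivFin G.edgeSet).injective h)⟩

/-- `Z₂`: the triangle `0 1 2` with the path `0 - 3 - 4` attached at the vertex `0`. -/
def Z2 : SimpleGraph (Fin 5) :=
  SimpleGraph.fromEdgeSet {s(0, 1), s(1, 2), s(2, 0), s(0, 3), s(3, 4)}

/-- `G_{6.3}`: two disjoint triangles joined by two disjoint edges. The vertices
`w, w₁, w₂, w₃, u₁, u₂` are `0, 1, 2, 3, 4, 5`; the triangles are `w w₂ w₃` and `w₁ u₁ u₂`,
the joining edges `w w₁` and `w₂ u₂`. -/
def G63 : SimpleGraph (Fin 6) :=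
  SimpleGraph.fromEdgeSet
    {s(0, 2), s(2, 3), s(3, 0), s(1, 4), s(4, 5), s(5, 1), s(0, 1), s(2, 5)}

end PRC

/-! Start from a proper colouring with `χ'(G)` colours and suppose that no rainbow path joins `u` to
`v`, where `deg u ≤ deg v`. Then `u` and `v` are non-adjacent and have no common neighbour. For
every edge `xy` with `x ∈ N(u)` and `y ∈ N(v)`, the path `u x y v` must fail, so `ux` and `vy` have
the same colour. By properness these edges `xy` form a matching. Hence at least `deg u * deg v - deg
u` pairs across the neighbourhoods are non-edges, while the edge bound leaves at most `deg u + deg v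
- 2` non-edges off `u, v`. So `(deg u - 1)(deg v - 2) ≤ 0`, and in the surviving cases both counts
are tight: every non-edge off `u, v` goes across, and the matching covers `N(u)`
(`structure_of_matching`). If `deg u = 1` and `deg v ≥ 3`, a rainbow path of length 4 exists after
all. The degree pairs `(1,1)`, `(1,2)`, `(2,2)` remain. A vertex `z` outside `N(u)`, `N(v)` and `{u,
v}` is adjacent to everything except `u, v`, which leaves room for a recolouring that adds no colour
and makes every pair joined (the `exists_joined_of_degree_*` lemmas). Without such a `z` the graph
has 4, 5 or 6 vertices and is one of the three exceptions. -/

namespace PRC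

open SimpleGraph

variable {V : Type*} {G : SimpleGraph V}

/-! ### Counting non-edges around a bad pair -/

section Structure

open scoped Classical in
/-- In a graph with at least `(n - 2).choose 2 + 2` edges, few non-edges avoid two given
non-adjacent vertices. -/
theorem card_nonedges_avoiding_pair_le [Fintype V] {u v : V} (huv : u ≠ v) (hadj : ¬G.Adj u v)
    (hm : (Fintype.card V - 2).choose 2 + 2 ≤ G.edgeFinset.card) :
    (Gᶜ.edgeFinset \ (Gᶜ.incidenceFinset u ∪ Gᶜ.incidenceFinset v)).card + 2 ≤
      G.degree u + G.degree v := by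
  have htot : G.edgeFinset.card + Gᶜ.edgeFinset.card = (Fintype.card V).choose 2 := by
    rw [← card_edgeFinset_top_eq_card_choose_two, ← Finset.card_union_of_disjoint
      (disjoint_edgeFinset.2 disjoint_compl_right), ← edgeFinset_sup]
    congr 1
    ext e
    simp only [mem_edgeFinset, sup_compl_eq_top]
  have hsub : Gᶜ.incidenceFinset u ∪ Gᶜ.incidenceFinset v ⊆ Gᶜ.edgeFinset :=
    Finset.union_subset (incidenceFinset_subset _ _) (incidenceFinset_subset _ _)
  have hinter : (Gᶜ.incidenceFinset u ∩ Gᶜ.incidenceFinset v).card = 1 := by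
    rw [Finset.card_eq_one]
    refine ⟨s(u, v), ?_⟩
    have h := Gᶜ.incidenceSet_inter_incidenceSet_of_adj (a := u) (b := v)
      ((compl_adj G u v).2 ⟨huv, hadj⟩)
    ext e
    have := Set.ext_iff.1 h e
    simpa using this
  have hunion := Finset.card_union_add_card_inter (Gᶜ.incidenceFinset u) (Gᶜ.incidenceFinset v)
  rw [hinter, card_incidenceFinset_eq_degree, card_incidenceFinset_eq_degree, degree_compl,
    degree_compl] at hunion
  have hsd := Finset.card_sdiff_add_card_eq_card hsub
  have hdu := G.degree_lt_card_verts u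
  have hdv := G.degree_lt_card_verts v
  have hcard : 2 ≤ Fintype.card V := by
    have := Finset.card_le_univ ({u, v} : Finset V)
    rwa [Finset.card_pair huv] at this
  obtain ⟨N, hN⟩ := Nat.exists_eq_add_of_le' hcard
  -- With `n = N + 2` there are at most `2N - 1` non-edges. Exactly `2N + 1 - deg u - deg v` of them
  -- meet `{u, v}`, the pair `uv` being counted once.
  have h1 : (N + 2).choose 2 = N.choose 2 + 2 * N + 1 := by
    rw [Nat.choose_succ_succ' (N + 1) 1, Nat.choose_succ_succ' N 1]
    simp
    omega
  rw [hN] at htot hm hunion hdu hdv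
  simp only [Nat.add_sub_cancel] at hm
  omega

/-- Distinct non-adjacent vertices other than `u`, `v` lie one in each of the neighbourhoods
of `u` and `v`. -/
def NonAdjAcross (G : SimpleGraph V) (u v : V) : Prop :=
  ∀ s t, s ≠ u → s ≠ v → t ≠ u → t ≠ v → s ≠ t → ¬G.Adj s t →
    (G.Adj u s ∧ G.Adj v t) ∨ (G.Adj u t ∧ G.Adj v s)

theorem NonAdjAcross.symm {u v : V} (h : NonAdjAcross G u v) : NonAdjAcross G v u := by
  intro s t h1 h2 h3 h4 h5 h6
  have := h s t h2 h1 h4 h3 h5 h6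
  tauto

open scoped Classical in
/-- The shape of a dense graph around two vertices `u`, `v` without common neighbours for which
the edges between the two neighbourhoods form a matching. -/
theorem structure_of_matching [Fintype V] {u v : V} (huv : u ≠ v) (hadj : ¬G.Adj u v)
    (hm : (Fintype.card V - 2).choose 2 + 2 ≤ G.edgeFinset.card)
    (hdisj : ∀ w, G.Adj u w → ¬G.Adj v w)
    (hleft : ∀ x y y', G.Adj u x → G.Adj v y → G.Adj v y' → G.Adj x y → G.Adj x y' → y = y')
    (hu : 1 ≤ G.degree u) (hle : G.degree u ≤ G.degree v) :
    (G.degree u = 1 ∨ (G.degree u = 2 ∧ G.degree v = 2)) ∧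
    NonAdjAcross G u v ∧
    (∀ x, G.Adj u x → ∃ y, G.Adj v y ∧ G.Adj x y) := by
  have hM := card_nonedges_avoiding_pair_le huv hadj hm
  set M := Gᶜ.edgeFinset \ (Gᶜ.incidenceFinset u ∪ Gᶜ.incidenceFinset v) with hMdef
  have memM : ∀ s t, s(s, t) ∈ M ↔ s ≠ t ∧ ¬G.Adj s t ∧ s ≠ u ∧ s ≠ v ∧ t ≠ u ∧ t ≠ v := by
    intro s t
    simp only [hMdef, Finset.mem_sdiff, mem_edgeFinset, mem_edgeSet, compl_adj, Finset.mem_union,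
      mem_incidenceFinset, mk'_mem_incidenceSet_iff]
    grind
  set AB := G.neighborFinset u ×ˢ G.neighborFinset v with hAB
  set P := AB.filter (fun p => G.Adj p.1 p.2) with hP
  set Q := AB.filter (fun p => ¬G.Adj p.1 p.2) with hQ
  have hPQ : P.card + Q.card = G.degree u * G.degree v := by
    rw [hP, hQ, Finset.card_filter_add_card_filter_not, hAB, Finset.card_product,
      card_neighborFinset_eq_degree, card_neighborFinset_eq_degree]
  have hPinj : Set.InjOn Prod.fst (P : Set (V × V)) := by
    rintro ⟨x, y⟩ h ⟨x', y'⟩ h' hxx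
    simp only [hP, hAB, Finset.coe_filter, Finset.mem_product, mem_neighborFinset,
      Set.mem_ofPred_eq] at h h' hxx
    subst hxx
    rw [hleft x y y' h.1.1 h.1.2 h'.1.2 h.2 h'.2]
  have hPsub : P.image Prod.fst ⊆ G.neighborFinset u := by
    intro x hx
    simp only [hP, hAB, Finset.mem_image, Finset.mem_filter, Finset.mem_product] at hx
    obtain ⟨p, hp, rfl⟩ := hx
    exact hp.1.1
  have hPcard : P.card ≤ G.degree u := by
    rw [← Finset.card_image_of_injOn hPinj, ← card_neighborFinset_eq_degree]
    exact Finset.card_le_card hPsub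
  have hQinj : Set.InjOn (fun p : V × V => s(p.1, p.2)) (Q : Set (V × V)) := by
    rintro ⟨x, y⟩ h ⟨x', y'⟩ h' hxx
    simp only [hQ, hAB, Finset.coe_filter, Finset.mem_product, mem_neighborFinset,
      Set.mem_ofPred_eq, Sym2.eq_iff] at h h' hxx
    rcases hxx with ⟨rfl, rfl⟩ | ⟨rfl, rfl⟩
    · rfl
    · exact absurd h'.1.2 (hdisj _ h.1.1)
  have hQsub : Q.image (fun p : V × V => s(p.1, p.2)) ⊆ M := by
    intro e he
    simp only [hQ, hAB, Finset.mem_image, Finset.mem_filter, Finset.mem_product,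
      mem_neighborFinset] at he
    obtain ⟨⟨x, y⟩, ⟨⟨hx, hy⟩, hxy⟩, rfl⟩ := he
    simp only at hx hy hxy
    rw [memM]
    refine ⟨?_, hxy, hx.ne', ?_, ?_, hy.ne'⟩
    · intro h
      have h' : x = y := h
      exact hdisj _ hx (h' ▸ hy)
    · rintro rfl
      exact hadj hx
    · rintro rfl
      exact hadj hy.symm
  have hQcard := Finset.card_le_card hQsub
  rw [Finset.card_image_of_injOn hQinj] at hQcard
  -- `deg u * deg v - deg u ≤ |Q| ≤ |M| ≤ deg u + deg v - 2` rearranges to `(deg u - 1)(deg v - 2) ≤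
  -- 0`.
  have hdeg : G.degree u = 1 ∨ (G.degree u = 2 ∧ G.degree v = 2) := by
    by_contra hcon
    have h2 : 2 ≤ G.degree u := by omega
    have h3 : 3 ≤ G.degree v := by omega
    obtain ⟨a, ha⟩ := Nat.exists_eq_add_of_le' h2
    obtain ⟨b, hb⟩ := Nat.exists_eq_add_of_le' h3
    rw [ha, hb] at hPQ hM
    rw [ha] at hPcard
    nlinarith [Nat.zero_le (a * b)]
  -- In both cases the chain of inequalities is tight. So `Q` accounts for all of `M`, and every
  -- neighbour of `u` is matched.
  have hPeq : P.card = G.degree u ∧ M.card ≤ Q.card := by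
    rcases hdeg with h | ⟨h, h'⟩
    · rw [h] at hPQ hPcard hM ⊢
      omega
    · rw [h, h'] at hPQ hM
      rw [h] at hPcard ⊢
      omega
  refine ⟨hdeg, ?_, ?_⟩
  · intro s t hsu hsv htu htv hst hnst
    have hmem := (memM s t).2 ⟨hst, hnst, hsu, hsv, htu, htv⟩
    have heq := Finset.eq_of_subset_of_card_le hQsub
      (by rw [Finset.card_image_of_injOn hQinj]; exact hPeq.2)
    rw [← heq] at hmem
    simp only [hQ, hAB, Finset.mem_image, Finset.mem_filter, Finset.mem_product,
      mem_neighborFinset] at hmem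
    obtain ⟨⟨x, y⟩, ⟨⟨hx, hy⟩, -⟩, hxy⟩ := hmem
    rcases Sym2.eq_iff.1 hxy with ⟨rfl, rfl⟩ | ⟨rfl, rfl⟩
    · exact Or.inl ⟨hx, hy⟩
    · exact Or.inr ⟨hx, hy⟩
  · intro x hx
    have heq := Finset.eq_of_subset_of_card_le hPsub
      (by rw [Finset.card_image_of_injOn hPinj, hPeq.1, card_neighborFinset_eq_degree])
    have hx' : x ∈ P.image Prod.fst := by
      rw [heq, mem_neighborFinset]
      exact hx
    simp only [hP, hAB, Finset.mem_image, Finset.mem_filter, Finset.mem_product,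
      mem_neighborFinset] at hx'
    obtain ⟨p, hp, rfl⟩ := hx'
    exact ⟨p.2, hp.1.2, hp.2⟩

end Structure

/-! ### Rainbow paths of length at most four -/

section Colouring

variable {K : Type*}

/-- Edges sharing a vertex get different values of `f`. -/
def ProperOn (G : SimpleGraph V) (f : Sym2 V → K) : Prop :=
  ∀ ⦃w a b⦄, G.Adj w a → G.Adj w b → a ≠ b → f s(w, a) ≠ f s(w, b)

/-- Some path from `s` to `t` has edges with pairwise distinct values of `f`. -/
def Joined (G : SimpleGraph V) (f : Sym2 V → K) (s t : V) : Prop :=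
  ∃ p : G.Walk s t, p.IsPath ∧ (p.edges.map f).Nodup

theorem Joined.symm {f : Sym2 V → K} {s t : V} (h : Joined G f s t) : Joined G f t s := by
  obtain ⟨p, hp, hn⟩ := h
  refine ⟨p.reverse, hp.reverse, ?_⟩
  rw [Walk.edges_reverse, List.map_reverse]
  exact List.nodup_reverse.2 hn

theorem Joined.refl (f : Sym2 V → K) (s : V) : Joined G f s s :=
  ⟨Walk.nil, by simp, by simp⟩

theorem Joined.of_adj (f : Sym2 V → K) {s t : V} (h : G.Adj s t) : Joined G f s t :=
  ⟨h.toWalk, by simp [h.ne], by simp⟩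

theorem Joined.of_two {f : Sym2 V → K} (hf : ProperOn G f) {s a t : V} (hsa : G.Adj s a)
    (hat : G.Adj a t) : Joined G f s t := by
  by_cases hst : s = t
  · subst hst
    exact Joined.refl f s
  · refine ⟨.cons hsa (.cons hat .nil), ?_, ?_⟩
    · simp [Walk.cons_isPath_iff, hsa.ne, hat.ne, hst]
    · have h := hf hsa.symm hat hst
      rw [Sym2.eq_swap] at h
      simpa using h

/-- Properness separates consecutive edges, so only edges at distance one or more along the path
need a colour hypothesis. -/
theorem Joined.of_three {f : Sym2 V → K} (hf : ProperOn G f) {s a b t : V} (hsa : G.Adj s a)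
    (hab : G.Adj a b) (hbt : G.Adj b t) (hsb : s ≠ b) (hat : a ≠ t) (hst : s ≠ t)
    (h : f s(s, a) ≠ f s(b, t)) : Joined G f s t := by
  refine ⟨.cons hsa (.cons hab (.cons hbt .nil)), ?_, ?_⟩
  · simp [Walk.cons_isPath_iff, hsa.ne, hab.ne, hbt.ne, hsb, hat, hst]
  · have h1 := hf hsa.symm hab hsb
    have h2 := hf hab.symm hbt hat
    rw [Sym2.eq_swap] at h1 h2
    simp [h, h1, h2]

theorem Joined.of_four {f : Sym2 V → K} (hf : ProperOn G f) {s a b c t : V} (hsa : G.Adj s a)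
    (hab : G.Adj a b) (hbc : G.Adj b c) (hct : G.Adj c t) (hsb : s ≠ b) (hsc : s ≠ c)
    (hst : s ≠ t) (hac : a ≠ c) (hat : a ≠ t) (hbt : b ≠ t)
    (h13 : f s(s, a) ≠ f s(b, c)) (h14 : f s(s, a) ≠ f s(c, t)) (h24 : f s(a, b) ≠ f s(c, t)) :
    Joined G f s t := by
  refine ⟨.cons hsa (.cons hab (.cons hbc (.cons hct .nil))), ?_, ?_⟩
  · simp [Walk.cons_isPath_iff, hsa.ne, hab.ne, hbc.ne, hct.ne, hsb, hsc, hst, hac, hat, hbt]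
  · have h1 := hf hsa.symm hab hsb
    have h2 := hf hab.symm hbc hac
    have h3 := hf hbc.symm hct hbt
    rw [Sym2.eq_swap] at h1 h2 h3
    simp [h13, h14, h24, h1, h2, h3]

theorem ProperOn.isProper {f : Sym2 V → K} (hf : ProperOn G f) :
    IsProper (fun e : G.edgeSet => f e) := by
  rintro ⟨e, he⟩ ⟨e', he'⟩ hne ⟨w, hw, hw'⟩
  obtain ⟨a, rfl⟩ := hw
  obtain ⟨b, rfl⟩ := hw'
  exact hf he he' (by rintro rfl; exact hne rfl)

theorem Joined.isRainbowPath {f : Sym2 V → K} {s t : V} (h : Joined G f s t) :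
    ∃ p : G.Walk s t, IsRainbowPath (fun e : G.edgeSet => f e) p := by
  obtain ⟨p, hp, hn⟩ := h
  refine ⟨p, hp, fun e e' he he' hne heq => hne (Subtype.ext ?_)⟩
  exact List.inj_on_of_nodup_map hn he he' heq

/-- A vertex of degree less than the number of colours misses a colour. -/
theorem exists_missing_colour [Fintype V] [DecidableRel G.Adj] {k : ℕ} (f : Sym2 V → Fin k)
    {x : V} (h : G.degree x < k) : ∃ j, ∀ w, G.Adj x w → f s(x, w) ≠ j := by
  classical
  by_contra! hcon
  have hsurj : (Finset.univ : Finset (Fin k)) ⊆ (G.neighborFinset x).image (fun w => f s(x, w)) := by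
    intro j _
    obtain ⟨w, hw, hj⟩ := hcon j
    exact Finset.mem_image.2 ⟨w, by simpa using hw, hj⟩
  have := (Finset.card_le_card hsurj).trans Finset.card_image_le
  simp at this
  omega

theorem ProperOn.degree_le [Fintype V] [DecidableRel G.Adj] {k : ℕ} {f : Sym2 V → Fin k}
    (hf : ProperOn G f) (x : V) : G.degree x ≤ k := by
  have h := Finset.card_le_card_of_injOn (s := G.neighborFinset x) (t := Finset.univ)
    (fun w => f s(x, w)) (fun _ _ => Finset.mem_univ _) (by
      intro a ha b hb hab
      by_contra hne
      simp only [Finset.mem_coe, mem_neighborFinset] at ha hb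
      exact hf ha hb hne hab)
  simpa using h

end Colouring

/-! ### Recolouring tools and reduction to one pair -/

section Repair

variable {K : Type*} {f : Sym2 V → K} {u v : V}

/-- A neighbour of `v` is reached through its partner in `N(u)`. A vertex outside both
neighbourhoods is adjacent to all of `N(u)`, since a missing edge would have to go across. -/
theorem joined_left_of_partners (hf : ProperOn G f) (hj : Joined G f u v)
    (hS : NonAdjAcross G u v)
    (hadj : ¬G.Adj u v) (hne : ∃ x, G.Adj u x)
    (hv : ∀ y, G.Adj v y → ∃ x, G.Adj u x ∧ G.Adj x y) (t : V) : Joined G f u t := by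
  by_cases htu : t = u
  · subst htu; exact Joined.refl f _
  by_cases htv : t = v
  · subst htv; exact hj
  by_cases h1 : G.Adj u t
  · exact Joined.of_adj f h1
  by_cases h2 : G.Adj v t
  · obtain ⟨x, hx, hxt⟩ := hv t h2
    exact Joined.of_two hf hx hxt
  · obtain ⟨x, hx⟩ := hne
    have hxt : G.Adj x t := by
      by_contra hn
      have := hS x t hx.ne' (by rintro rfl; exact hadj hx) htu htv
        (by rintro rfl; exact h1 hx) hn
      tauto
    exact Joined.of_two hf hx hxt

/-- If the two neighbourhoods are matched perfectly and some vertex lies outside them, then only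
the pair `u`, `v` needs to be joined. -/
theorem joined_of_partners (hf : ProperOn G f) (hj : Joined G f u v)
    (hS : NonAdjAcross G u v)
    (hadj : ¬G.Adj u v) (hneu : ∃ x, G.Adj u x) (hnev : ∃ y, G.Adj v y)
    (hu : ∀ x, G.Adj u x → ∃ y, G.Adj v y ∧ G.Adj x y)
    (hv : ∀ y, G.Adj v y → ∃ x, G.Adj u x ∧ G.Adj x y)
    {z : V} (hzu : z ≠ u) (hzv : z ≠ v) (hz : ¬G.Adj u z) (hz' : ¬G.Adj v z) (s t : V) :
    Joined G f s t := by
  have hU : ∀ t, Joined G f u t := joined_left_of_partners hf hj hS hadj hneu hv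
  have hV : ∀ t, Joined G f v t := by
    refine joined_left_of_partners hf hj.symm hS.symm (fun h => hadj h.symm) hnev ?_
    intro x hx
    obtain ⟨y, hy, hxy⟩ := hu x hx
    exact ⟨y, hy, hxy.symm⟩
  by_cases hsu : s = u
  · subst hsu; exact hU t
  by_cases hsv : s = v
  · subst hsv; exact hV t
  by_cases htu : t = u
  · subst htu; exact (hU s).symm
  by_cases htv : t = v
  · subst htv; exact (hV s).symm
  by_cases hst : s = t
  · subst hst; exact Joined.refl f _
  by_cases hadj' : G.Adj s t
  · exact Joined.of_adj f hadj'
  have hzw : ∀ w, w ≠ u → w ≠ v → w ≠ z → G.Adj z w := by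
    intro w hwu hwv hwz
    by_contra hn
    have := hS z w hzu hzv hwu hwv hwz.symm hn
    tauto
  have hST := hS s t hsu hsv htu htv hst hadj'
  have hsz : s ≠ z := by rintro rfl; tauto
  have htz : t ≠ z := by rintro rfl; tauto
  -- The non-adjacent `s`, `t` lie across the two neighbourhoods, so both differ from `z` and have
  -- it as a common neighbour.
  exact Joined.of_two hf (hzw s hsu hsv hsz).symm (hzw t htu htv htz)

open scoped Classical in
/-- Swapping two colours on a set of edges closed under adjacency among these colours. -/
theorem ProperOn.swap_on (hf : ProperOn G f) (T : Finset (Sym2 V)) (p q : K)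
    (hval : ∀ e ∈ T, f e = p ∨ f e = q)
    (hout : ∀ w x y, G.Adj w x → G.Adj w y → s(w, x) ∈ T → s(w, y) ∉ T →
      f s(w, y) ≠ p ∧ f s(w, y) ≠ q) :
    ProperOn G (fun e => if e ∈ T then Equiv.swap p q (f e) else f e) := by
  have hTval : ∀ e ∈ T, Equiv.swap p q (f e) = p ∨ Equiv.swap p q (f e) = q := by
    intro e he
    rcases hval e he with h | h <;> simp [h]
  intro w x y hx hy hxy
  have hfxy := hf hx hy hxy
  by_cases hxT : s(w, x) ∈ T <;> by_cases hyT : s(w, y) ∈ T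
  · simpa [hxT, hyT] using hfxy
  · have := hout w x y hx hy hxT hyT
    have := hTval _ hxT
    simp only [hxT, hyT, if_true, if_false]
    grind
  · have := hout w y x hy hx hyT hxT
    have := hTval _ hyT
    simp only [hxT, hyT, if_true, if_false]
    grind
  · simpa [hxT, hyT] using hfxy

/-- Swapping the two colours of an alternating 4-cycle. -/
theorem exists_swap_fourCycle (hf : ProperOn G f) {a b c d : V} (hab : G.Adj a b)
    (hbc : G.Adj b c) (hcd : G.Adj c d) (hda : G.Adj d a) (hac : a ≠ c) (hbd : b ≠ d)
    (h1 : f s(a, b) = f s(c, d)) (h2 : f s(b, c) = f s(d, a)) :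
    ∃ f' : Sym2 V → K, ProperOn G f' ∧ f' s(a, b) = f s(b, c) ∧
      ∀ e, e ≠ s(a, b) → e ≠ s(b, c) → e ≠ s(c, d) → e ≠ s(d, a) → f' e = f e := by
  classical
  let T : Finset (Sym2 V) := {s(a, b), s(b, c), s(c, d), s(d, a)}
  have hT : ∀ e, e ∈ T ↔ e = s(a, b) ∨ e = s(b, c) ∨ e = s(c, d) ∨ e = s(d, a) := by
    intro e; simp [T]
  have hout : ∀ w x y, G.Adj w y → s(w, x) ∈ T → s(w, y) ∉ T →
      f s(w, y) ≠ f s(a, b) ∧ f s(w, y) ≠ f s(b, c) := by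
    -- Each vertex of the cycle already meets both colours on the cycle, so no other edge there can
    -- carry either of them.
    have key : ∀ {w p q y : V}, G.Adj w p → G.Adj w q → G.Adj w y → s(w, p) ∈ T → s(w, q) ∈ T →
        s(w, y) ∉ T → f s(w, y) ≠ f s(w, p) ∧ f s(w, y) ≠ f s(w, q) := by
      intro w p q y hp hq hy hpT hqT hyT
      exact ⟨hf hy hp (by rintro rfl; exact hyT hpT), hf hy hq (by rintro rfl; exact hyT hqT)⟩
    intro w x y hy hx hyT
    have hw : w = a ∨ w = b ∨ w = c ∨ w = d := by
      rw [hT] at hx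
      simp only [Sym2.eq_iff] at hx
      tauto
    rcases hw with rfl | rfl | rfl | rfl
    · have := key hab hda.symm hy (by simp [T]) (by simp [T, Sym2.eq_swap]) hyT
      rwa [Sym2.eq_swap (a := w) (b := d), ← h2] at this
    · have := key hab.symm hbc hy (by simp [T, Sym2.eq_swap]) (by simp [T]) hyT
      rwa [Sym2.eq_swap (a := w) (b := a)] at this
    · have := key hcd hbc.symm hy (by simp [T]) (by simp [T, Sym2.eq_swap]) hyT
      rwa [Sym2.eq_swap (a := w) (b := b), ← h1] at this
    · have := key hcd.symm hda hy (by simp [T, Sym2.eq_swap]) (by simp [T]) hyT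
      rwa [Sym2.eq_swap (a := w) (b := c), ← h1, ← h2] at this
  refine ⟨_, hf.swap_on T (f s(a, b)) (f s(b, c)) ?_ (fun w x y _ => hout w x y), ?_, ?_⟩
  · intro e he
    rcases (hT e).1 he with rfl | rfl | rfl | rfl <;> simp [h1, h2]
  · have : s(a, b) ∈ T := by simp [T]
    simp [this]
  · intro e e1 e2 e3 e4
    have : e ∉ T := by rw [hT]; tauto
    simp [this]

/-- Recolouring the edges incident to a vertex of degree one. -/
theorem properOn_update_pendant [DecidableEq V] {x : V} (hux : G.Adj u x)
    (hu : ∀ w, G.Adj u w → w = x)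
    (hf : ∀ w a b, G.Adj w a → G.Adj w b → a ≠ b → s(w, a) ≠ s(u, x) → s(w, b) ≠ s(u, x) →
      f s(w, a) ≠ f s(w, b)) {j : K} (hj : ∀ w, G.Adj x w → w ≠ u → f s(x, w) ≠ j) :
    ProperOn G (Function.update f s(u, x) j) := by
  have haux : ∀ w a b, G.Adj w a → G.Adj w b → a ≠ b → s(w, a) = s(u, x) →
      s(w, b) ≠ s(u, x) ∧ f s(w, b) ≠ j := by
    intro w a b ha hb hab h
    rcases Sym2.eq_iff.1 h with ⟨rfl, rfl⟩ | ⟨rfl, rfl⟩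
    · exact absurd (hu b hb).symm hab
    · refine ⟨?_, hj b hb hab.symm⟩
      intro h'
      rcases Sym2.eq_iff.1 h' with ⟨h1, -⟩ | ⟨-, h1⟩
      · exact hux.ne' h1
      · exact hab h1.symm
  intro w a b ha hb hab
  by_cases h1 : s(w, a) = s(u, x)
  · obtain ⟨h2, h3⟩ := haux w a b ha hb hab h1
    rw [Function.update_of_ne h2, h1, Function.update_self]
    exact h3.symm
  · by_cases h2 : s(w, b) = s(u, x)
    · obtain ⟨-, h3⟩ := haux w b a hb ha hab.symm h2
      rw [Function.update_of_ne h1, h2, Function.update_self]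
      exact h3
    · rw [Function.update_of_ne h1, Function.update_of_ne h2]
      exact hf w a b ha hb hab h1 h2

end Repair

/-! ### Recognising the three exceptional graphs -/

section Isomorphisms

theorem nonempty_iso_of_enumeration {m : ℕ} {H : SimpleGraph (Fin m)} (g : Fin m → V)
    (hinj : Function.Injective g) (hsurj : Function.Surjective g)
    (h : ∀ i j, i < j → (G.Adj (g i) (g j) ↔ H.Adj i j)) : Nonempty (G ≃g H) := by
  have hbij : Function.Bijective g := ⟨hinj, hsurj⟩
  refine ⟨RelIso.symm ⟨Equiv.ofBijective g hbij, ?_⟩⟩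
  intro i j
  change G.Adj (g i) (g j) ↔ H.Adj i j
  rcases lt_trichotomy i j with hij | rfl | hij
  · exact h i j hij
  · simp
  · rw [G.adj_comm, H.adj_comm]
    exact h j i hij

theorem nonempty_iso_pathGraph_four {u x y v : V} (hall : ∀ w, w = u ∨ w = x ∨ w = y ∨ w = v)
    (hux : G.Adj u x) (hxy : G.Adj x y) (hyv : G.Adj y v) (huy : ¬G.Adj u y) (huv : ¬G.Adj u v)
    (hxv : ¬G.Adj x v) (huy' : u ≠ y) (huv' : u ≠ v) (hxv' : x ≠ v) :
    Nonempty (G ≃g pathGraph 4) := by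
  refine nonempty_iso_of_enumeration ![u, x, y, v] ?_ ?_ ?_
  · intro i j
    have := hux.ne; have := hxy.ne; have := hyv.ne
    fin_cases i <;> fin_cases j <;> simp <;> grind
  · intro w
    rcases hall w with rfl | rfl | rfl | rfl
    exacts [⟨0, rfl⟩, ⟨1, rfl⟩, ⟨2, rfl⟩, ⟨3, rfl⟩]
  · intro i j hij
    rw [pathGraph_adj]
    fin_cases i <;> fin_cases j <;> simp at hij ⊢ <;> assumption

theorem nonempty_iso_Z2 {u x y y' v : V}
    (hall : ∀ w, w = u ∨ w = x ∨ w = y ∨ w = y' ∨ w = v)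
    (hux : G.Adj u x) (hxy : G.Adj x y) (hyv : G.Adj y v) (hyy' : G.Adj y y') (hyv' : G.Adj y' v)
    (huy : ¬G.Adj u y) (huy' : ¬G.Adj u y') (huv : ¬G.Adj u v) (hxy' : ¬G.Adj x y')
    (hxv : ¬G.Adj x v) (huy₁ : u ≠ y) (huy₂ : u ≠ y') (huv' : u ≠ v) (hxy₂ : x ≠ y')
    (hxv' : x ≠ v) : Nonempty (G ≃g Z2) := by
  refine nonempty_iso_of_enumeration ![y, y', v, x, u] ?_ ?_ ?_
  · intro i j
    have := hux.ne; have := hxy.ne; have := hyv.ne; have := hyy'.ne; have := hyv'.ne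
    fin_cases i <;> fin_cases j <;> simp <;> grind
  · intro w
    rcases hall w with rfl | rfl | rfl | rfl | rfl
    exacts [⟨4, rfl⟩, ⟨3, rfl⟩, ⟨0, rfl⟩, ⟨1, rfl⟩, ⟨2, rfl⟩]
  · intro i j hij
    rw [Z2]
    fin_cases i <;> fin_cases j <;> simp at hij ⊢ <;> first | assumption | (rw [G.adj_comm]; assumption)

theorem nonempty_iso_G63 {u x₁ x₂ y₁ y₂ v : V}
    (hall : ∀ w, w = u ∨ w = x₁ ∨ w = x₂ ∨ w = y₁ ∨ w = y₂ ∨ w = v)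
    (hu1 : G.Adj u x₁) (hu2 : G.Adj u x₂) (hx : G.Adj x₁ x₂) (hv1 : G.Adj v y₁) (hv2 : G.Adj v y₂)
    (hy : G.Adj y₁ y₂) (h11 : G.Adj x₁ y₁) (h22 : G.Adj x₂ y₂)
    (huv : ¬G.Adj u v) (huy1 : ¬G.Adj u y₁) (huy2 : ¬G.Adj u y₂) (hvx1 : ¬G.Adj v x₁)
    (hvx2 : ¬G.Adj v x₂) (h12 : ¬G.Adj x₁ y₂) (h21 : ¬G.Adj x₂ y₁) (huv' : u ≠ v) :
    Nonempty (G ≃g G63) := by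
  -- The triangles `w w₂ w₃` and `w₁ u₁ u₂` are `x₁ x₂ u` and `y₁ v y₂`; the matching supplies the
  -- joining edges.
  refine nonempty_iso_of_enumeration ![x₁, y₁, x₂, u, v, y₂] ?_ ?_ ?_
  · intro i j
    have := hu1.ne; have := hu2.ne; have := hx.ne; have := hv1.ne; have := hv2.ne
    have := hy.ne; have := h11.ne; have := h22.ne
    have := hu1.symm; have := hu2.symm; have := hv1.symm; have := hv2.symm
    fin_cases i <;> fin_cases j <;> simp <;> grind
  · intro w
    rcases hall w with rfl | rfl | rfl | rfl | rfl | rfl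
    exacts [⟨3, rfl⟩, ⟨0, rfl⟩, ⟨2, rfl⟩, ⟨1, rfl⟩, ⟨5, rfl⟩, ⟨4, rfl⟩]
  · intro i j hij
    rw [G63]
    fin_cases i <;> fin_cases j <;> simp at hij ⊢ <;> first | assumption | (rw [G.adj_comm]; assumption)

end Isomorphisms

/-! ### Recolouring for each pair of degrees -/

section Cases

variable {K : Type*} {f : Sym2 V → K} {u v : V}

/-- The paths `u x₁ z y₂ v` and `u x₂ z y₁ v` fail too. The resulting colour coincidences make one
of the 4-cycles `v y₁ z y₂`, `u x₁ z x₂` alternating, and swapping its colours breaks the equality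
of `ux₁` and `vy₁`. -/
theorem exists_joined_of_degree_two_two (hf : ProperOn G f) (hbad : ¬Joined G f u v)
    (hS : NonAdjAcross G u v) (huv : u ≠ v) (hadj : ¬G.Adj u v)
    (hdisj : ∀ w, G.Adj u w → ¬G.Adj v w)
    (hcol : ∀ x y, G.Adj u x → G.Adj v y → G.Adj x y → f s(u, x) = f s(v, y))
    {x₁ x₂ y₁ y₂ z : V} (hu : ∀ w, G.Adj u w ↔ w = x₁ ∨ w = x₂)
    (hv : ∀ w, G.Adj v w ↔ w = y₁ ∨ w = y₂) (hx : x₁ ≠ x₂) (hy : y₁ ≠ y₂)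
    (h11 : G.Adj x₁ y₁) (h22 : G.Adj x₂ y₂) (hzu : z ≠ u) (hzv : z ≠ v)
    (hz : ¬G.Adj u z) (hz' : ¬G.Adj v z) :
    ∃ f' : Sym2 V → K, ProperOn G f' ∧ ∀ s t, Joined G f' s t := by
  have hu1 : G.Adj u x₁ := (hu _).2 (Or.inl rfl)
  have hu2 : G.Adj u x₂ := (hu _).2 (Or.inr rfl)
  have hv1 : G.Adj v y₁ := (hv _).2 (Or.inl rfl)
  have hv2 : G.Adj v y₂ := (hv _).2 (Or.inr rfl)
  have hvx1 := hdisj _ hu1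
  have hvx2 := hdisj _ hu2
  have huy1 : ¬G.Adj u y₁ := fun h => hdisj _ h hv1
  have huy2 : ¬G.Adj u y₂ := fun h => hdisj _ h hv2
  have hux : ∀ w, G.Adj u w → w ≠ v := by rintro w h rfl; exact hadj h
  have hvx : ∀ w, G.Adj v w → w ≠ u := by rintro w h rfl; exact hadj h.symm
  have hzw : ∀ w, w ≠ u → w ≠ v → w ≠ z → G.Adj z w := by
    intro w hwu hwv hwz
    by_contra hn
    have := hS z w hzu hzv hwu hwv hwz.symm hn
    tauto
  have hzx1 := hzw x₁ hu1.ne' (hux _ hu1) (by rintro rfl; exact hz hu1)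
  have hzx2 := hzw x₂ hu2.ne' (hux _ hu2) (by rintro rfl; exact hz hu2)
  have hzy1 := hzw y₁ (hvx _ hv1) hv1.ne' (by rintro rfl; exact hz' hv1)
  have hzy2 := hzw y₂ (hvx _ hv2) hv2.ne' (by rintro rfl; exact hz' hv2)
  have c1 := hcol _ _ hu1 hv1 h11
  have c2 := hcol _ _ hu2 hv2 h22
  have c12 := hf hu1 hu2 hx
  have hxy12 : x₁ ≠ y₂ := by rintro rfl; exact huy2 hu1
  have hxy21 : x₂ ≠ y₁ := by rintro rfl; exact huy1 hu2
  have hxy11 := h11.ne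
  have hxy22 := h22.ne
  have finish : ∀ f' : Sym2 V → K, ProperOn G f' → f' s(u, x₁) ≠ f' s(v, y₁) →
      ∃ f' : Sym2 V → K, ProperOn G f' ∧ ∀ s t, Joined G f' s t := by
    intro f' hf' hne
    rw [Sym2.eq_swap (a := v)] at hne
    have hj : Joined G f' u v :=
      Joined.of_three hf' hu1 h11 hv1.symm (hvx _ hv1).symm (hux _ hu1) huv hne
    refine ⟨f', hf', joined_of_partners hf' hj hS hadj ⟨_, hu1⟩ ⟨_, hv1⟩ ?_ ?_ hzu hzv hz hz'⟩
    · intro x hx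
      rcases (hu x).1 hx with rfl | rfl
      exacts [⟨_, hv1, h11⟩, ⟨_, hv2, h22⟩]
    · intro y hy
      rcases (hv y).1 hy with rfl | rfl
      exacts [⟨_, hu1, h11⟩, ⟨_, hu2, h22⟩]
  have b1 : f s(u, x₁) = f s(z, y₂) ∨ f s(x₁, z) = f s(y₂, v) := by
    by_contra! hcon
    refine hbad (Joined.of_four hf hu1 hzx1.symm hzy2 hv2.symm hzu.symm (hvx _ hv2).symm huv
      hxy12 (hux _ hu1) hzv hcon.1 ?_ hcon.2)
    rw [Sym2.eq_swap (b := v), ← c2]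
    exact c12
  have b2 : f s(u, x₂) = f s(z, y₁) ∨ f s(x₂, z) = f s(y₁, v) := by
    by_contra! hcon
    refine hbad (Joined.of_four hf hu2 hzx2.symm hzy1 hv1.symm hzu.symm (hvx _ hv1).symm huv
      hxy21 (hux _ hu2) hzv hcon.1 ?_ hcon.2)
    rw [Sym2.eq_swap (b := v), ← c1]
    exact c12.symm
  -- The two mixed cases would give two edges at `z` the same colour.
  rcases b1 with b1 | b1 <;> rcases b2 with b2 | b2
  · obtain ⟨f', hf', h1, h2⟩ := exists_swap_fourCycle hf hv1 hzy1.symm hzy2 hv2.symm hzv.symm hy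
      (by rw [← c1, b1]) (by rw [Sym2.eq_swap, ← b2, c2, Sym2.eq_swap])
    refine finish f' hf' ?_
    rw [h1, h2, Sym2.eq_swap (a := y₁), ← b2]
    · exact c12
    all_goals
      intro h
      simp only [Sym2.eq_iff] at h
      grind
  · exfalso
    refine hf hzx2 hzy2 hxy22 ?_
    rw [Sym2.eq_swap, b2, ← b1, c1, Sym2.eq_swap]
  · exfalso
    refine hf hzx1 hzy1 hxy11 ?_
    rw [Sym2.eq_swap, b1, ← b2, c2, Sym2.eq_swap]
  · obtain ⟨f', hf', h1, h2⟩ := exists_swap_fourCycle hf hu1 hzx1.symm hzx2 hu2.symm hzu.symm hx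
      (by rw [Sym2.eq_swap (a := z), b2, c1, Sym2.eq_swap])
      (by rw [b1, Sym2.eq_swap (b := v), ← c2, Sym2.eq_swap])
    refine finish f' hf' ?_
    rw [h1, h2, b1, Sym2.eq_swap (b := v), ← c2, ← c1]
    · exact c12.symm
    all_goals
      intro h
      simp only [Sym2.eq_iff] at h
      grind

/-- On `u x y a v` and `u x y b v` the only possible clash is between `xy` and the last edge. As
`va` and `vb` differ in colour, one of the two paths is rainbow. -/
theorem joined_of_three_neighbours (hf : ProperOn G f) (huv : u ≠ v) (hadj : ¬G.Adj u v)
    (hdisj : ∀ w, G.Adj u w → ¬G.Adj v w) {x y a b : V} (hux : G.Adj u x) (hxy : G.Adj x y)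
    (hvy : G.Adj v y) (hva : G.Adj v a) (hvb : G.Adj v b) (hab : a ≠ b) (hya : G.Adj y a)
    (hyb : G.Adj y b) (hcol : f s(u, x) = f s(v, y)) : Joined G f u v := by
  have key : ∀ w, G.Adj v w → G.Adj y w → f s(x, y) ≠ f s(w, v) → Joined G f u v := by
    intro w hvw hyw hne
    have hvx : ∀ w, G.Adj v w → w ≠ u := by rintro w h rfl; exact hadj h.symm
    refine Joined.of_four hf hux hxy hyw hvw.symm (hvx _ hvy).symm (hvx _ hvw).symm huv ?_ ?_
      hvy.ne' ?_ ?_ hne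
    · rintro rfl; exact hdisj _ hux hvw
    · rintro rfl; exact hadj hux
    · rw [hcol, Sym2.eq_swap]
      exact hf hvy.symm hyw hvw.ne
    · rw [hcol, Sym2.eq_swap (b := v)]
      exact hf hvy hvw hyw.ne
  by_cases h : f s(x, y) = f s(a, v)
  · refine key b hvb hyb ?_
    rw [h, Sym2.eq_swap, Sym2.eq_swap (a := b)]
    exact hf hva hvb hab
  · exact key a hva hya h

/-- Here `xy'` is the only non-edge off `u, v`, so `deg x < deg y` and `x` misses a colour, which is
given to the pendant edge `ux`. Since `y'` has no partner in `N(u)`, `joined_of_partners` does not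
apply and the pairs are checked directly. -/
theorem exists_joined_of_degree_one_two [Fintype V] [DecidableRel G.Adj] {k : ℕ}
    {f : Sym2 V → Fin k} (hf : ProperOn G f)
    (hS : NonAdjAcross G u v) (huv : u ≠ v) (hadj : ¬G.Adj u v)
    (hdisj : ∀ w, G.Adj u w → ¬G.Adj v w)
    {x y y' z : V} (hu : ∀ w, G.Adj u w ↔ w = x) (hv : ∀ w, G.Adj v w ↔ w = y ∨ w = y')
    (hyy : y ≠ y') (hxy : G.Adj x y) (hxy' : ¬G.Adj x y') (hzu : z ≠ u) (hzv : z ≠ v)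
    (hz : ¬G.Adj u z) (hz' : ¬G.Adj v z) (hcol : f s(u, x) = f s(v, y)) :
    ∃ f' : Sym2 V → Fin k, ProperOn G f' ∧ ∀ s t, Joined G f' s t := by
  classical
  have hux : G.Adj u x := (hu _).2 rfl
  have hvy : G.Adj v y := (hv _).2 (Or.inl rfl)
  have hvy' : G.Adj v y' := (hv _).2 (Or.inr rfl)
  have huy : ¬G.Adj u y := fun h => hdisj _ h hvy
  have huy' : ¬G.Adj u y' := fun h => hdisj _ h hvy'
  have hvx := hdisj _ hux
  have hxv : x ≠ v := by rintro rfl; exact hadj hux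
  have hyu : y ≠ u := by rintro rfl; exact hadj hvy.symm
  have hyu' : y' ≠ u := by rintro rfl; exact hadj hvy'.symm
  have hxy'' : x ≠ y' := by rintro rfl; exact huy' hux
  have complete : ∀ s t, s ≠ u → s ≠ v → t ≠ u → t ≠ v → s ≠ t →
      ¬(s = x ∧ t = y') → ¬(t = x ∧ s = y') → G.Adj s t := by
    intro s t h1 h2 h3 h4 h5 h6 h7
    by_contra hn
    have := hS s t h1 h2 h3 h4 h5 hn
    rw [hu, hv, hu, hv] at this
    grind [G.adj_comm]
  have hyyadj : G.Adj y y' := complete _ _ hyu hvy.ne' hyu' hvy'.ne' hyy (by grind) (by grind)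
  have hdeg : G.degree x < G.degree y := by
    have hsub : insert x (insert v (insert y' (((G.neighborFinset x).erase u).erase y))) ⊆
        G.neighborFinset y := by
      intro w hw
      simp only [Finset.mem_insert, Finset.mem_erase, mem_neighborFinset] at hw ⊢
      rcases hw with rfl | rfl | rfl | ⟨h1, h2, h3⟩
      · exact hxy.symm
      · exact hvy.symm
      · exact hyyadj
      · refine complete _ _ hyu hvy.ne' h2 ?_ h1.symm (by grind) (by grind)
        rintro rfl
        exact hvx h3.symm
    have hle := Finset.card_le_card hsub
    rw [Finset.card_insert_of_notMem, Finset.card_insert_of_notMem, Finset.card_insert_of_notMem,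
      Finset.card_erase_of_mem, Finset.card_erase_of_mem, card_neighborFinset_eq_degree,
      card_neighborFinset_eq_degree] at hle
    · omega
    · simpa using hux.symm
    · simp [hyu, hxy]
    · simp [hxy']
    · simp [hvy'.ne, G.adj_comm x v, hvx]
    · simp [hxv, hxy'']
  obtain ⟨j, hj⟩ := exists_missing_colour f (hdeg.trans_le (hf.degree_le y))
  have hf' : ProperOn G (Function.update f s(u, x) j) :=
    properOn_update_pendant hux (fun w hw => (hu w).1 hw)
      (fun w a b ha hb hab _ _ => hf ha hb hab) (fun w hw _ => hj w hw)
  set f' := Function.update f s(u, x) j with hf'def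
  have hout : ∀ e, u ∉ e → f' e = f e := by
    intro e he
    rw [hf'def, Function.update_of_ne]
    rintro rfl
    simp at he
  have hzw : ∀ w, w ≠ u → w ≠ v → w ≠ z → G.Adj z w := by
    intro w hwu hwv hwz
    refine complete _ _ hzu hzv hwu hwv hwz.symm ?_ ?_
    · rintro ⟨rfl, -⟩; exact hz hux
    · rintro ⟨-, rfl⟩; exact hz' hvy'
  have hzx : G.Adj z x := hzw x hux.ne' hxv (by rintro rfl; exact hz hux)
  have hzy' : G.Adj z y' := hzw y' hyu' hvy'.ne' (by rintro rfl; exact hz' hvy')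
  have hyz : y ≠ z := by rintro rfl; exact hz' hvy
  have juv : Joined G f' u v := by
    refine Joined.of_three hf' hux hxy hvy.symm hyu.symm hxv huv ?_
    rw [hout s(y, v) (by simp [hyu.symm, huv]), hf'def, Function.update_self, Sym2.eq_swap,
      ← hcol, Sym2.eq_swap]
    exact (hj u hux.symm).symm
  -- The edges `yy'` and `zy'` differ in colour, so one of `u x y y'`, `u x z y'` is rainbow.
  have juy' : Joined G f' u y' := by
    by_cases h : f' s(u, x) = f' s(y, y')
    · refine Joined.of_three hf' hux hzx.symm hzy' hzu.symm hxy'' hyu'.symm ?_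
      rw [h, Sym2.eq_swap, Sym2.eq_swap (a := z)]
      exact hf' hyyadj.symm hzy'.symm hyz
    · exact Joined.of_three hf' hux hxy hyyadj hyu.symm hxy'' hyu'.symm h
  have hU : ∀ t, Joined G f' u t := by
    intro t
    by_cases h1 : t = u
    · subst h1; exact Joined.refl _ _
    by_cases h2 : t = v
    · subst h2; exact juv
    by_cases h3 : t = y'
    · subst h3; exact juy'
    by_cases h4 : t = x
    · subst h4; exact Joined.of_adj _ hux
    · exact Joined.of_two hf' hux
        (complete _ _ hux.ne' hxv h1 h2 (Ne.symm h4) (by grind) (by grind))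
  have hV : ∀ t, Joined G f' v t := by
    intro t
    by_cases h1 : t = u
    · subst h1; exact juv.symm
    by_cases h2 : t = v
    · subst h2; exact Joined.refl _ _
    by_cases h3 : t = y
    · subst h3; exact Joined.of_adj _ hvy
    · exact Joined.of_two hf' hvy
        (complete _ _ hyu hvy.ne' h1 h2 (Ne.symm h3) (by grind) (by grind))
  have hxy'j : Joined G f' x y' := Joined.of_two hf' hxy hyyadj
  refine ⟨f', hf', ?_⟩
  intro s t
  by_cases h1 : s = u
  · subst h1; exact hU t
  by_cases h2 : s = v
  · subst h2; exact hV t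
  by_cases h3 : t = u
  · subst h3; exact (hU s).symm
  by_cases h4 : t = v
  · subst h4; exact (hV s).symm
  by_cases h5 : s = t
  · subst h5; exact Joined.refl _ _
  by_cases h6 : s = x ∧ t = y'
  · obtain ⟨rfl, rfl⟩ := h6; exact hxy'j
  by_cases h7 : t = x ∧ s = y'
  · obtain ⟨rfl, rfl⟩ := h7; exact hxy'j.symm
  · exact Joined.of_adj _ (complete s t h1 h2 h3 h4 h5 h6 h7)

/-- Off `u, v` the graph is complete, so `deg z < deg y` and `z` misses a colour `j`. It suffices to
give `ux` and `vy` different colours. -/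
theorem exists_joined_of_degree_one_one [Fintype V] [DecidableRel G.Adj] {k : ℕ}
    {f : Sym2 V → Fin k} (hf : ProperOn G f)
    (hS : NonAdjAcross G u v) (huv : u ≠ v) (hadj : ¬G.Adj u v)
    (hdisj : ∀ w, G.Adj u w → ¬G.Adj v w)
    {x y z : V} (hu : ∀ w, G.Adj u w ↔ w = x) (hv : ∀ w, G.Adj v w ↔ w = y)
    (hxy : G.Adj x y) (hzu : z ≠ u) (hzv : z ≠ v)
    (hz : ¬G.Adj u z) (hz' : ¬G.Adj v z) (hcol : f s(u, x) = f s(v, y)) :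
    ∃ f' : Sym2 V → Fin k, ProperOn G f' ∧ ∀ s t, Joined G f' s t := by
  classical
  have hux : G.Adj u x := (hu _).2 rfl
  have hvy : G.Adj v y := (hv _).2 rfl
  have huy : ¬G.Adj u y := fun h => hdisj _ h hvy
  have hvx := hdisj _ hux
  have hxv : x ≠ v := by rintro rfl; exact hadj hux
  have hyu : y ≠ u := by rintro rfl; exact hadj hvy.symm
  have hzx' : z ≠ x := by rintro rfl; exact hz hux
  have hzy' : z ≠ y := by rintro rfl; exact hz' hvy
  have complete : ∀ s t, s ≠ u → s ≠ v → t ≠ u → t ≠ v → s ≠ t → G.Adj s t := by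
    intro s t h1 h2 h3 h4 h5
    by_contra hn
    have := hS s t h1 h2 h3 h4 h5 hn
    rw [hu, hv, hu, hv] at this
    grind [G.adj_comm]
  have hzx : G.Adj z x := complete _ _ hzu hzv hux.ne' hxv hzx'
  have hzy : G.Adj z y := complete _ _ hzu hzv hyu hvy.ne' hzy'
  have finish : ∀ f' : Sym2 V → Fin k, ProperOn G f' → f' s(u, x) ≠ f' s(v, y) →
      ∃ f' : Sym2 V → Fin k, ProperOn G f' ∧ ∀ s t, Joined G f' s t := by
    intro f' hf' hne
    rw [Sym2.eq_swap (a := v)] at hne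
    have hj : Joined G f' u v := Joined.of_three hf' hux hxy hvy.symm hyu.symm hxv huv hne
    refine ⟨f', hf', joined_of_partners hf' hj hS hadj ⟨_, hux⟩ ⟨_, hvy⟩ ?_ ?_ hzu hzv hz hz'⟩
    · intro x' hx
      rw [(hu x').1 hx]
      exact ⟨_, hvy, hxy⟩
    · intro y' hy
      rw [(hv y').1 hy]
      exact ⟨_, hux, hxy⟩
  have hdeg : G.degree z < G.degree y := by
    have hsub : insert z (insert v ((G.neighborFinset z).erase y)) ⊆ G.neighborFinset y := by
      intro w hw
      simp only [Finset.mem_insert, Finset.mem_erase, mem_neighborFinset] at hw ⊢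
      rcases hw with rfl | rfl | ⟨h1, h2⟩
      · exact hzy.symm
      · exact hvy.symm
      · refine complete _ _ hyu hvy.ne' ?_ ?_ h1.symm
        · rintro rfl; exact hz h2.symm
        · rintro rfl; exact hz' h2.symm
    have hle := Finset.card_le_card hsub
    rw [Finset.card_insert_of_notMem, Finset.card_insert_of_notMem,
      Finset.card_erase_of_mem, card_neighborFinset_eq_degree,
      card_neighborFinset_eq_degree] at hle
    · omega
    · simpa using hzy
    · simp [G.adj_comm z v, hz']
    · simp [hzv]
  obtain ⟨j, hj⟩ := exists_missing_colour f (hdeg.trans_le (hf.degree_le y))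
  -- If `z` misses the colour of `ux`, then `u x z` is a whole two-coloured component: `u` is
  -- pendant and the component stops at `z`. Its colours can be swapped.
  by_cases hju : j = f s(u, x)
  · have hT : ∀ e, e ∈ ({s(u, x), s(x, z)} : Finset (Sym2 V)) ↔ e = s(u, x) ∨ e = s(x, z) := by
      simp
    refine finish _ (hf.swap_on {s(u, x), s(x, z)} (f s(u, x)) (f s(x, z)) ?_ ?_) ?_
    · intro e he
      rcases (hT e).1 he with rfl | rfl <;> simp
    · intro w a b ha hb haT hbT
      rw [hT] at haT hbT
      simp only [Sym2.eq_iff] at haT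
      have hwx : w = u ∨ w = x ∨ w = z := by tauto
      rcases hwx with rfl | rfl | rfl
      · exact absurd (by rw [(hu b).1 hb]; exact Or.inl rfl) hbT
      · rw [Sym2.eq_swap (a := u)]
        refine ⟨hf hb hux.symm ?_, hf hb hzx.symm ?_⟩
        · rintro rfl; exact hbT (Or.inl Sym2.eq_swap)
        · rintro rfl; exact hbT (Or.inr rfl)
      · rw [Sym2.eq_swap (a := x)]
        refine ⟨hju ▸ hj b hb, hf hb hzx ?_⟩
        rintro rfl; exact hbT (Or.inr Sym2.eq_swap)
    · have h1 : s(v, y) ∉ ({s(u, x), s(x, z)} : Finset (Sym2 V)) := by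
        rw [hT]
        simp only [Sym2.eq_iff]
        grind
      have h2 : s(u, x) ∈ ({s(u, x), s(x, z)} : Finset (Sym2 V)) := by simp
      simp only [h1, h2, if_true, if_false, Equiv.swap_apply_left]
      rw [← hcol, Sym2.eq_swap (a := u)]
      exact hf hzx.symm hux.symm hzu
  -- Exchanging `y` and `z` is an automorphism of `G - v` fixing `u` and `x`. In the transported
  -- colouring `y` misses `j` on its edges other than `vy`, so `vy` can take `j`, which differs from
  -- the colour of `ux`.
  · set σ := Equiv.swap y z with hσ
    have hσu : σ u = u := Equiv.swap_apply_of_ne_of_ne hyu.symm hzu.symm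
    have hσv : σ v = v := Equiv.swap_apply_of_ne_of_ne hvy.ne hzv.symm
    have hσx : σ x = x := Equiv.swap_apply_of_ne_of_ne hxy.ne hzx'.symm
    have hσadj : ∀ w a, G.Adj w a → w ≠ v → a ≠ v → G.Adj (σ w) (σ a) := by
      intro w a h hw ha
      by_cases hwu : w = u
      · subst hwu
        rw [(hu a).1 h, hσu, hσx]
        exact hux
      by_cases hau : a = u
      · subst hau
        rw [(hu w).1 h.symm, hσu, hσx]
        exact hux.symm
      · refine complete _ _ ?_ ?_ ?_ ?_ (σ.injective.ne h.ne)
        · rw [← hσu]; exact σ.injective.ne hwu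
        · rw [← hσv]; exact σ.injective.ne hw
        · rw [← hσu]; exact σ.injective.ne hau
        · rw [← hσv]; exact σ.injective.ne ha
    have hnev : ∀ w a, G.Adj w a → s(w, a) ≠ s(v, y) → w ≠ v ∧ a ≠ v := by
      intro w a h hne
      constructor
      · rintro rfl
        exact hne (by rw [(hv a).1 h])
      · rintro rfl
        exact hne (by rw [(hv w).1 h.symm, Sym2.eq_swap])
    have hf' : ProperOn G (Function.update (fun e => f (e.map σ)) s(v, y) j) := by
      refine properOn_update_pendant hvy (fun w hw => (hv w).1 hw) ?_ ?_
      · intro w a b ha hb hab h1 h2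
        obtain ⟨hw, ha'⟩ := hnev w a ha h1
        obtain ⟨-, hb'⟩ := hnev w b hb h2
        simp only [Sym2.map_mk]
        exact hf (hσadj w a ha hw ha') (hσadj w b hb hw hb') (σ.injective.ne hab)
      · intro w hw hwv
        have := hσadj y w hw hvy.ne' hwv
        rw [hσ, Equiv.swap_apply_left] at this
        simp only [Sym2.map_mk]
        rw [hσ, Equiv.swap_apply_left]
        exact hj _ this
    refine finish _ hf' ?_
    rw [Function.update_self, Function.update_of_ne]
    · simp only [Sym2.map_mk]
      rw [hσu, hσx]
      exact Ne.symm hju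
    · intro h
      rcases Sym2.eq_iff.1 h with ⟨h1, -⟩ | ⟨h1, -⟩
      · exact huv h1
      · exact hyu h1.symm

end Cases

/-! ### From a bad pair to a repaired colouring or an exception -/

section Main

theorem exists_joined_or_exceptional [Fintype V] [Fintype G.edgeSet] (hG : G.Connected)
    (hm : (Fintype.card V - 2).choose 2 + 2 ≤ G.edgeFinset.card) {k : ℕ} {f : Sym2 V → Fin k}
    (hf : ProperOn G f) {u v : V} (hbad : ¬Joined G f u v)
    (hle : (G.neighborSet u).ncard ≤ (G.neighborSet v).ncard) :
    (∃ f' : Sym2 V → Fin k, ProperOn G f' ∧ ∀ s t, Joined G f' s t) ∨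
      Nonempty (G ≃g pathGraph 4) ∨ Nonempty (G ≃g Z2) ∨ Nonempty (G ≃g G63) := by
  classical
  have huv : u ≠ v := by rintro rfl; exact hbad (Joined.refl _ _)
  have hadj : ¬G.Adj u v := fun h => hbad (Joined.of_adj _ h)
  have hdisj : ∀ w, G.Adj u w → ¬G.Adj v w := fun w h h' => hbad (Joined.of_two hf h h'.symm)
  have hux : ∀ w, G.Adj u w → w ≠ v := by rintro w h rfl; exact hadj h
  have hvx : ∀ w, G.Adj v w → w ≠ u := by rintro w h rfl; exact hadj h.symm
  have hcol : ∀ x y, G.Adj u x → G.Adj v y → G.Adj x y → f s(u, x) = f s(v, y) := by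
    intro x y hx hy hxy
    by_contra hne
    rw [Sym2.eq_swap (a := v)] at hne
    exact hbad (Joined.of_three hf hx hxy hy.symm (hvx _ hy).symm (hux _ hx) huv hne)
  have hleft : ∀ x y y', G.Adj u x → G.Adj v y → G.Adj v y' → G.Adj x y → G.Adj x y' → y = y' := by
    intro x y y' hx hy hy' h h'
    by_contra hne
    exact hf hy hy' hne ((hcol x y hx hy h).symm.trans (hcol x y' hx hy' h'))
  have hright : ∀ x x' y, G.Adj u x → G.Adj u x' → G.Adj v y → G.Adj x y → G.Adj x' y →
      x = x' := by
    intro x x' y hx hx' hy h h'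
    by_contra hne
    exact hf hx hx' hne ((hcol x y hx hy h).trans (hcol x' y hx' hy h').symm)
  have hdeg : ∀ w, (G.neighborSet w).ncard = G.degree w := by
    intro w
    rw [← card_neighborSet_eq_degree, Set.ncard_eq_toFinset_card', Set.toFinset_card]
  rw [hdeg, hdeg] at hle
  have : Nontrivial V := ⟨u, v, huv⟩
  have hu1 : 1 ≤ G.degree u := hG.preconnected.degree_pos_of_nontrivial u
  obtain ⟨hd, hS, hpart⟩ :=
    structure_of_matching huv hadj (by convert hm) hdisj hleft hu1 hle
  have hnonadj : ∀ s t, s ≠ u → s ≠ v → t ≠ u → t ≠ v → s ≠ t →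
      ¬(G.Adj u s ∧ G.Adj v t) → ¬(G.Adj u t ∧ G.Adj v s) → G.Adj s t := by
    intro s t h1 h2 h3 h4 h5 h6 h7
    by_contra hn
    exact (hS s t h1 h2 h3 h4 h5 hn).elim h6 h7
  have two : ∀ w, G.degree w = 2 → ∃ a b, a ≠ b ∧ ∀ t, G.Adj w t ↔ t = a ∨ t = b := by
    intro w hw
    rw [← card_neighborFinset_eq_degree, Finset.card_eq_two] at hw
    obtain ⟨a, b, hab, h⟩ := hw
    refine ⟨a, b, hab, fun t => ?_⟩
    rw [← mem_neighborFinset, h]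
    simp
  have one : ∀ w a, G.degree w = 1 → G.Adj w a → ∀ t, G.Adj w t ↔ t = a := by
    intro w a hw ha t
    obtain ⟨b, -, hb⟩ := degree_eq_one_iff_existsUnique_adj.1 hw
    exact ⟨fun ht => (hb t ht).trans (hb a ha).symm, fun ht => ht ▸ ha⟩
  obtain ⟨x, hx⟩ : ∃ x, G.Adj u x := (G.degree_pos_iff_exists_adj u).1 hu1
  obtain ⟨y, hy, hxy⟩ := hpart x hx
  have huy : ¬G.Adj u y := fun h => hdisj _ h hy
  have hvx' := hdisj _ hx
  rcases hd with hd | ⟨hd, hd'⟩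
  · have hu := one u x hd hx
    have hadjB : ∀ w, G.Adj v w → w ≠ y → G.Adj y w := by
      intro w hw hwy
      exact hnonadj y w (hvx _ hy) hy.ne' (hvx _ hw) hw.ne' hwy.symm (fun h => huy h.1)
        (fun h => hdisj _ h.1 hw)
    rcases Nat.lt_or_ge 2 (G.degree v) with h3 | h3
    · exfalso
      have hcard : 1 < ((G.neighborFinset v).erase y).card := by
        rw [Finset.card_erase_of_mem (by simpa using hy), card_neighborFinset_eq_degree]
        omega
      obtain ⟨a, ha, b, hb, hab⟩ := Finset.one_lt_card.1 hcard
      simp only [Finset.mem_erase, mem_neighborFinset] at ha hb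
      exact hbad (joined_of_three_neighbours hf huv hadj hdisj hx hxy hy ha.2 hb.2 hab
        (hadjB a ha.2 ha.1) (hadjB b hb.2 hb.1) (hcol x y hx hy hxy))
    · have hd2 : G.degree v = 1 ∨ G.degree v = 2 := by omega
      rcases hd2 with hd2 | hd2
      · have hv := one v y hd2 hy
        -- Without such a `z`, the vertices are exactly `u`, `v` and their neighbours.
        by_cases hz : ∃ z, z ≠ u ∧ z ≠ v ∧ ¬G.Adj u z ∧ ¬G.Adj v z
        · obtain ⟨z, h1, h2, h3, h4⟩ := hz
          exact Or.inl (exists_joined_of_degree_one_one hf hS huv hadj hdisj hu hv hxy h1 h2 h3 h4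
            (hcol x y hx hy hxy))
        · push Not at hz
          refine Or.inr (Or.inl (nonempty_iso_pathGraph_four (u := u) (x := x) (y := y) (v := v)
            ?_ hx hxy hy.symm huy hadj (fun h => hvx' h.symm) (hvx _ hy).symm huv (hux _ hx)))
          intro w
          have := hz w
          rw [hu, hv] at this
          tauto
      · obtain ⟨y', hyy', hv⟩ : ∃ y', y ≠ y' ∧ ∀ t, G.Adj v t ↔ t = y ∨ t = y' := by
          obtain ⟨a, b, hab, h⟩ := two v hd2
          rcases (h y).1 hy with rfl | rfl
          · exact ⟨b, hab, h⟩
          · exact ⟨a, hab.symm, fun t => (h t).trans or_comm⟩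
        have hy' : G.Adj v y' := (hv _).2 (Or.inr rfl)
        have hxy' : ¬G.Adj x y' := fun h => hyy' (hleft x y y' hx hy hy' hxy h)
        by_cases hz : ∃ z, z ≠ u ∧ z ≠ v ∧ ¬G.Adj u z ∧ ¬G.Adj v z
        · obtain ⟨z, h1, h2, h3, h4⟩ := hz
          exact Or.inl (exists_joined_of_degree_one_two hf hS huv hadj hdisj hu hv hyy' hxy hxy'
            h1 h2 h3 h4 (hcol x y hx hy hxy))
        · push Not at hz
          refine Or.inr (Or.inr (Or.inl (nonempty_iso_Z2 (u := u) (x := x) (y := y) (y' := y')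
            (v := v) ?_ hx hxy hy.symm (hadjB y' hy' hyy'.symm) hy'.symm huy
            (fun h => hdisj _ h hy') hadj hxy' (fun h => hvx' h.symm) (hvx _ hy).symm
            (hvx _ hy').symm huv ?_ (hux _ hx))))
          · intro w
            have := hz w
            rw [hu, hv] at this
            tauto
          · rintro rfl
            exact hvx' hy'
  · obtain ⟨x₁, x₂, hx12, hu⟩ := two u hd
    have hu1 : G.Adj u x₁ := (hu _).2 (Or.inl rfl)
    have hu2 : G.Adj u x₂ := (hu _).2 (Or.inr rfl)
    obtain ⟨y₁, hv1, h11⟩ := hpart x₁ hu1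
    obtain ⟨y₂, hv2, h22⟩ := hpart x₂ hu2
    have hy12 : y₁ ≠ y₂ := by
      rintro rfl
      exact hx12 (hright x₁ x₂ y₁ hu1 hu2 hv1 h11 h22)
    have hv : ∀ w, G.Adj v w ↔ w = y₁ ∨ w = y₂ := by
      obtain ⟨a, b, hab, h⟩ := two v hd'
      have ha := (h y₁).1 hv1
      have hb := (h y₂).1 hv2
      intro w
      rw [h]
      grind
    by_cases hz : ∃ z, z ≠ u ∧ z ≠ v ∧ ¬G.Adj u z ∧ ¬G.Adj v z
    · obtain ⟨z, h1, h2, h3, h4⟩ := hz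
      exact Or.inl (exists_joined_of_degree_two_two hf hbad hS huv hadj hdisj hcol hu hv hx12 hy12
        h11 h22 h1 h2 h3 h4)
    · push Not at hz
      refine Or.inr (Or.inr (Or.inr (nonempty_iso_G63 (u := u) (v := v) ?_ hu1 hu2
        (hnonadj x₁ x₂ hu1.ne' (hux _ hu1) hu2.ne' (hux _ hu2) hx12
          (fun h => hdisj _ hu2 h.2) (fun h => hdisj _ hu1 h.2)) hv1 hv2
        (hnonadj y₁ y₂ (hvx _ hv1) hv1.ne' (hvx _ hv2) hv2.ne' hy12
          (fun h => hdisj _ h.1 hv1) (fun h => hdisj _ h.1 hv2)) h11 h22 hadj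
        (fun h => hdisj _ h hv1) (fun h => hdisj _ h hv2) (hdisj _ hu1) (hdisj _ hu2)
        (fun h => hy12 (hleft x₁ y₁ y₂ hu1 hv1 hv2 h11 h))
        (fun h => hy12 (hleft x₂ y₁ y₂ hu2 hv1 hv2 h h22)) huv)))
      intro w
      have := hz w
      rw [hu, hv] at this
      tauto

end Main

end PRC

theorem mainTheorem4 {V : Type*} [Fintype V] (G : SimpleGraph V)
    [Fintype G.edgeSet] (hG : G.Connected) (hn : 3 ≤ Fintype.card V)
    (hm : (Fintype.card V - 2).choose 2 + 2 ≤ G.edgeFinset.card) :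
    PRC.prc G = PRC.chromaticIndex G ∨
      Nonempty (G ≃g SimpleGraph.pathGraph 4) ∨
      Nonempty (G ≃g PRC.Z2) ∨
      Nonempty (G ≃g PRC.G63) := by
  classical
  obtain ⟨c, hc⟩ := Nat.sInf_mem (PRC.chromaticIndex_set_nonempty (G := G))
  change G.EdgeLabeling (Fin (PRC.chromaticIndex G)) at c
  have hedge : G.edgeFinset.Nonempty := Finset.card_pos.1 (by omega)
  obtain ⟨e₀, he₀⟩ := hedge
  rw [SimpleGraph.mem_edgeFinset] at he₀
  let f : Sym2 V → Fin (PRC.chromaticIndex G) :=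
    -- Off the edge set the value is arbitrary; the edge `e₀` only provides some colour.
    fun e => if h : e ∈ G.edgeSet then c ⟨e, h⟩ else c ⟨e₀, he₀⟩
  have hf : PRC.ProperOn G f := by
    intro w a b ha hb hab
    have ha' : s(w, a) ∈ G.edgeSet := ha
    have hb' : s(w, b) ∈ G.edgeSet := hb
    simp only [f, ha', hb', dif_pos]
    refine hc ⟨s(w, a), ha⟩ ⟨s(w, b), hb⟩ ?_ ⟨w, by simp, by simp⟩
    intro h
    exact hab (Sym2.congr_right.1 (congrArg Subtype.val h))
  have good : (∃ f' : Sym2 V → Fin (PRC.chromaticIndex G), PRC.ProperOn G f' ∧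
      ∀ s t, PRC.Joined G f' s t) → PRC.prc G = PRC.chromaticIndex G := by
    rintro ⟨f', hf', hj⟩
    apply le_antisymm
    · exact Nat.sInf_le ⟨fun e => f' e, hf'.isProper, fun s t => (hj s t).isRainbowPath⟩
    · obtain ⟨c', hc', -⟩ := Nat.sInf_mem (PRC.prc_set_nonempty hG)
      exact Nat.sInf_le ⟨c', hc'⟩
  by_cases hall : ∀ s t, PRC.Joined G f s t
  · exact Or.inl (good ⟨f, hf, hall⟩)
  push Not at hall
  obtain ⟨u, v, huv⟩ := hall
  -- Being joined is symmetric, so the vertex of smaller degree may be taken first.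
  rcases le_total (G.neighborSet u).ncard (G.neighborSet v).ncard with hle | hle
  · exact (PRC.exists_joined_or_exceptional hG hm hf huv hle).imp_left good
  · exact (PRC.exists_joined_or_exceptional hG hm hf (fun h => huv h.symm) hle).imp_left good
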